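/- For $A,q\in\mathbb C$ with $|q|<1$ and $n\ge 0$ write $(A;q)_n=\prod_{k=0}^{n-1}(1-Aq^k)$, $(A;q)_\infty=\prod_{k=0}^{\infty}(1-Aq^k)$, and $(A_1,\dots,A_j;q)_\infty=(A_1;q)_\infty\cdots(A_j;q)_\infty$. Let $f(a,b)=\sum_{j=-\infty}^{\infty}a^{j(j+1)/2}b^{j(j-1)/2}$ for $|ab|<1$ be Ramanujan's theta function, and $f(-q)=f(-q,-q^2)$. **Theorem.** Let $m$ be a positive integer, and let $z,q\in\mathbb C$ with $z,q\neq 0$ and $|q|<1$. Then $$\sum_{r=0}^{m-1}q^{3r(r-1)/2}z^r\sum_{n=0}^{\infty}\frac{q^{m^2(n^2+n)}\left(-q^{3m^2/2}z^mq^{3m(r-1/2)};q^{m^2}\right)_{n+1}\left(\dfrac{-1}{q^{m^2/2}z^mq^{3m(r-1/2)}};q^{m^2}\right)_n}{(q^{m^2};q^{m^2})_{2n+1}}=\frac{(-z,-q^3/z,q^3;q^3)_\infty}{(q^{m^2};q^{m^2})_\infty},$$ where all the inner series converge absolutely. Here $q^{1/2}$ is either of the two square roots of $q$. The case $m=1$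 (with $q=x^2$, $z=a$) is, term by term on the left, the identity $$\sum_{n=0}^{\infty}\frac{x^{2n(n+1)}(-a;x^2)_{n+1}(-x^2/a;x^2)_n}{(x^2;x^2)_{2n+1}}=\frac{f(a,x^6/a)}{f(-x^2)},$$ which holds for all $a,x\in\mathbb C$ with $a\ne0$ and $|x|<1$ (its series converging absolutely). -/

import Mathlib

/-- The finite rising `q`-factorial `(A; q)_n = (1 - A)(1 - A q) ⋯ (1 - A q^(n-1))`. -/
noncomputable def qPoch (A q : ℂ) (n : ℕ) : ℂ :=
  ∏ k ∈ Finset.range n, (1 - A * q ^ k)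

/-- The infinite rising `q`-factorial `(A; q)_∞ = (1 - A)(1 - A q)(1 - A q^2) ⋯`
(convergent for `|q| < 1`, see `qPochInf_multipliable`). -/
noncomputable def qPochInf (A q : ℂ) : ℂ :=
  ∏' k : ℕ, (1 - A * q ^ k)

/-- The product defining `(A; q)_∞` converges for `|q| < 1`. -/
theorem qPochInf_multipliable (A q : ℂ) (hq : ‖q‖ < 1) :
    Multipliable fun k : ℕ => 1 - A * q ^ k := by
  have h : Multipliable fun k : ℕ => 1 + (-(A * q ^ k)) := by
    apply multipliable_one_add_of_summable
    simpa using (summable_geometric_of_lt_one (norm_nonneg q) hq).mul_left ‖A‖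
  simpa [sub_eq_add_neg] using h

/-- The product `(A; q)_∞` is the limit of the finite products `(A; q)_n`, for `|q| < 1`. -/
theorem qPoch_tendsto (A q : ℂ) (hq : ‖q‖ < 1) :
    Filter.Tendsto (qPoch A q) Filter.atTop (nhds (qPochInf A q)) :=
  (qPochInf_multipliable A q hq).hasProd.tendsto_prod_nat

/-- Ramanujan's theta function `f(a, b) = ∑_{j ∈ ℤ} a^(j(j+1)/2) b^(j(j-1)/2)`.
Both exponents are nonnegative integers (the divisions by `2` are exact). -/
noncomputable def ramanujanTheta (a b : ℂ) : ℂ :=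
  ∑' j : ℤ, a ^ (j * (j + 1) / 2) * b ^ (j * (j - 1) / 2)

/-- The `n`-th term of the inner series with index `r` of the `m`-dissection,
where `q = s ^ 2`, so that `s` plays the role of `q^(1/2)`:
`q^(m²(n²+n)) (-q^(3m²/2) z^m q^(3m(r-1/2)); q^(m²))_(n+1)
  (-1/(q^(m²/2) z^m q^(3m(r-1/2))); q^(m²))_n / (q^(m²); q^(m²))_(2n+1)`. -/
noncomputable def dissectionTerm (m : ℕ) (z q s : ℂ) (r n : ℕ) : ℂ :=
  q ^ (m ^ 2 * (n ^ 2 + n))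
    * qPoch (-(s ^ (3 * m ^ 2) * z ^ m * s ^ (3 * (m : ℤ) * (2 * (r : ℤ) - 1)))) (q ^ m ^ 2) (n + 1)
    * qPoch (-1 / (s ^ m ^ 2 * z ^ m * s ^ (3 * (m : ℤ) * (2 * (r : ℤ) - 1)))) (q ^ m ^ 2) n
    / qPoch (q ^ m ^ 2) (q ^ m ^ 2) (2 * n + 1)

/-- The `n`-th term of the series on the left of the partner identity:
`x^(2n(n+1)) (-a; x²)_(n+1) (-x²/a; x²)_n / (x²; x²)_(2n+1)`. -/
noncomputable def partnerTerm (a x : ℂ) (n : ℕ) : ℂ :=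
  x ^ (2 * n * (n + 1)) * qPoch (-a) (x ^ 2) (n + 1) * qPoch (-x ^ 2 / a) (x ^ 2) n
    / qPoch (x ^ 2) (x ^ 2) (2 * n + 1)

/-! Everything follows from one series. With $R(e)=1/(Q;Q)_e$, zero for $e<0$, the finite Jacobi
triple product expands $(-a;Q)_{n+1}(-Q/a;Q)_n/(Q;Q)_{2n+1}$ as $\sum_j
a^jQ^{j(j-1)/2}R(n+j)R(n+1-j)$ (`hasSum_finite_jacobi`). Multiply by $Q^{n^2+n}$ and sum over $n$
first: Cauchy's identity gives $Q^{j(j-1)}/(Q;Q)_\infty$ (`hasSum_cauchy_diagonal`), leaving the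
theta series of base $Q^3$ divided by $(Q;Q)_\infty$ (`hasSum_oddTerm`). For $Q=q^{m^2}$ and the
stated arguments, the $r$-th theta series is the part of $\sum_k z^kq^{3k(k-1)/2}$ with $k\equiv r
\pmod m$ (`thetaTerm_dissection`). Adding the classes and applying the triple product proves the
dissection; $Q=x^2$ gives the partner identity. -/

open Filter Topology

/-! ### Reciprocal q-factorials and theta terms -/

/-- The reciprocal `1 / (Q; Q)_e`, extended by `0` to negative integers `e`. -/
noncomputable def qPochRecip (Q : ℂ) (e : ℤ) : ℂ :=
  if e < 0 then 0 else (qPoch Q Q e.toNat)⁻¹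

theorem HasSum.of_eq {ι : Type*} {f g : ι → ℂ} {s t : ℂ} (h : HasSum f s) (hf : ∀ i, g i = f i)
    (hs : t = s) : HasSum g t := by
  rw [funext hf, hs]
  exact h

/-- The triangular exponent `j (j - 1) / 2`. -/
def triExp (j : ℤ) : ℤ := j * (j - 1) / 2

/-- The general term `a^j Q^(j(j-1)/2)` of the theta series. -/
noncomputable def thetaTerm (a Q : ℂ) (j : ℤ) : ℂ := a ^ j * Q ^ triExp j

theorem two_mul_triExp (j : ℤ) : 2 * triExp j = j * (j - 1) :=
  Int.mul_ediv_cancel' (by simpa using (Int.even_mul_pred_self j).two_dvd)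

theorem triExp_add_one (j : ℤ) : triExp (j + 1) = triExp j + j := by
  have h1 := two_mul_triExp j
  have h2 := two_mul_triExp (j + 1)
  linarith

theorem qPoch_succ (A Q : ℂ) (n : ℕ) : qPoch A Q (n + 1) = qPoch A Q n * (1 - A * Q ^ n) :=
  Finset.prod_range_succ _ _

theorem one_sub_pow_ne_zero {Q : ℂ} (hQ : ‖Q‖ < 1) (n : ℕ) : 1 - Q * Q ^ n ≠ 0 := by
  intro h
  have h1 : ‖Q ^ (n + 1)‖ = 1 := by
    rw [pow_succ', ← sub_eq_zero.mp h, norm_one]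
  rw [norm_pow] at h1
  exact absurd h1 (pow_lt_one₀ (norm_nonneg _) hQ (Nat.succ_ne_zero n)).ne

theorem qPoch_self_ne_zero {Q : ℂ} (hQ : ‖Q‖ < 1) (n : ℕ) : qPoch Q Q n ≠ 0 :=
  Finset.prod_ne_zero_iff.mpr fun k _ => one_sub_pow_ne_zero hQ k

theorem qPochRecip_natCast (Q : ℂ) (n : ℕ) : qPochRecip Q n = (qPoch Q Q n)⁻¹ := by
  simp [qPochRecip]

theorem qPochRecip_of_neg (Q : ℂ) {e : ℤ} (he : e < 0) : qPochRecip Q e = 0 := if_pos he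

theorem qPochRecip_zero (Q : ℂ) : qPochRecip Q 0 = 1 := by
  simp [qPochRecip, qPoch]

/-- At $e=0$ the factor $1-Q^0$ vanishes, so the extension by zero obeys one recurrence on all of
$\mathbb Z$ and later sums need no boundary terms. -/
theorem qPochRecip_sub_one {Q : ℂ} (hQ : ‖Q‖ < 1) (e : ℤ) :
    qPochRecip Q (e - 1) = (1 - Q ^ e) * qPochRecip Q e := by
  rcases lt_trichotomy e 0 with he | rfl | he
  · rw [qPochRecip_of_neg Q he, qPochRecip_of_neg Q (by lia), mul_zero]
  · rw [qPochRecip_of_neg Q (by lia)]; simp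
  · obtain ⟨n, rfl⟩ : ∃ n : ℕ, e = ((n + 1 : ℕ) : ℤ) := ⟨(e - 1).toNat, by lia⟩
    rw [show ((n + 1 : ℕ) : ℤ) - 1 = (n : ℤ) by push_cast; ring, qPochRecip_natCast,
      qPochRecip_natCast, qPoch_succ, zpow_natCast, pow_succ']
    have h1 := qPoch_self_ne_zero hQ n
    have h2 := one_sub_pow_ne_zero hQ n
    field_simp

theorem qPochRecip_eq_add_one {Q : ℂ} (hQ : ‖Q‖ < 1) (e : ℤ) :
    qPochRecip Q e = (1 - Q ^ (e + 1)) * qPochRecip Q (e + 1) := by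
  rw [← qPochRecip_sub_one hQ, add_sub_cancel_right]

/-! ### Finite Jacobi triple product -/

theorem hasSum_finite_jacobi_zero (a Q : ℂ) :
    HasSum (fun j : ℤ => thetaTerm a Q j * qPochRecip Q j * qPochRecip Q (-j)) 1 := by
  have h : HasSum (fun j : ℤ => thetaTerm a Q j * qPochRecip Q j * qPochRecip Q (-j))
      (thetaTerm a Q 0 * qPochRecip Q 0 * qPochRecip Q (-0)) := by
    refine hasSum_single 0 fun j hj => ?_
    rcases lt_or_gt_of_ne hj with h | h
    · rw [qPochRecip_of_neg Q h]; simp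
    · rw [qPochRecip_of_neg Q (e := -j) (by lia)]; simp
  simpa [thetaTerm, triExp, qPochRecip_zero] using h

theorem thetaTerm_add_one {a Q : ℂ} (ha : a ≠ 0) (h0 : Q ≠ 0) (j : ℤ) :
    thetaTerm a Q (j + 1) = a * Q ^ j * thetaTerm a Q j := by
  simp only [thetaTerm, triExp_add_one, zpow_add₀ ha, zpow_add₀ h0, zpow_one]
  ring

theorem one_sub_zpow_ne_zero {Q : ℂ} (hQ : ‖Q‖ < 1) {e : ℤ} (he : 0 < e) : 1 - Q ^ e ≠ 0 := by
  obtain ⟨n, rfl⟩ : ∃ n : ℕ, e = ((n + 1 : ℕ) : ℤ) := ⟨(e - 1).toNat, by lia⟩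
  rw [zpow_natCast, pow_succ']
  exact one_sub_pow_ne_zero hQ n

/-- A q-Pascal rule: $1-Q^{n+m+1}=(1-Q^{n+1-j})+Q^{n+1-j}(1-Q^{m+j})$ writes the new $j$-th term,
times the left side, as the old $j$-th term plus $aQ^n$ times the old $(j-1)$-st. -/
theorem hasSum_finite_jacobi_left {a Q S : ℂ} (ha : a ≠ 0) (h0 : Q ≠ 0) (hQ : ‖Q‖ < 1) {n m : ℤ}
    (hnm : 0 ≤ n + m)
    (h : HasSum (fun j : ℤ =>
      thetaTerm a Q j * qPochRecip Q (m + j) * qPochRecip Q (n - j)) (S * qPochRecip Q (n + m))) :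
    HasSum (fun j : ℤ => thetaTerm a Q j * qPochRecip Q (m + j) * qPochRecip Q (n + 1 - j))
      (S * (1 + a * Q ^ n) * qPochRecip Q (n + 1 + m)) := by
  have hz := one_sub_zpow_ne_zero hQ (e := n + m + 1) (by lia)
  have h' := (Equiv.subRight (1 : ℤ)).hasSum_iff.mpr (h.mul_left (a * Q ^ n))
  have h2 := (h.add h').mul_left (1 - Q ^ (n + m + 1))⁻¹
  rw [qPochRecip_eq_add_one hQ (n + m)] at h2
  refine h2.of_eq (fun j => ?_) ?_
  · have e1 : thetaTerm a Q j = a * Q ^ (j - 1) * thetaTerm a Q (j - 1) := by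
      rw [← thetaTerm_add_one ha h0, sub_add_cancel]
    have e2 : qPochRecip Q (m + (j - 1)) = (1 - Q ^ (m + j)) * qPochRecip Q (m + j) := by
      rw [← qPochRecip_sub_one hQ]; ring_nf
    have e3 : qPochRecip Q (n - j) = (1 - Q ^ (n + 1 - j)) * qPochRecip Q (n + 1 - j) := by
      rw [← qPochRecip_sub_one hQ]; ring_nf
    have e4 : qPochRecip Q (n - (j - 1)) = qPochRecip Q (n + 1 - j) := by ring_nf
    have e5 : Q ^ n = Q ^ (n + 1 - j) * Q ^ (j - 1) := by
      rw [← zpow_add₀ h0]; ring_nf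
    have e6 : Q ^ (n + m + 1) = Q ^ (n + 1 - j) * Q ^ (m + j) := by
      rw [← zpow_add₀ h0]; ring_nf
    rw [eq_inv_mul_iff_mul_eq₀ hz]
    simp only [Function.comp_apply, Equiv.subRight_apply]
    rw [e1, e2, e3, e4, e5, e6]
    ring
  · rw [eq_inv_mul_iff_mul_eq₀ hz, show n + 1 + m = n + m + 1 by ring]
    ring

theorem hasSum_finite_jacobi_right {a Q S : ℂ} (ha : a ≠ 0) (h0 : Q ≠ 0) (hQ : ‖Q‖ < 1) {n m : ℤ}
    (hnm : 0 ≤ n + m)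
    (h : HasSum (fun j : ℤ =>
      thetaTerm a Q j * qPochRecip Q (m + j) * qPochRecip Q (n - j)) (S * qPochRecip Q (n + m))) :
    HasSum (fun j : ℤ => thetaTerm a Q j * qPochRecip Q (m + 1 + j) * qPochRecip Q (n - j))
      (S * (1 + Q / a * Q ^ m) * qPochRecip Q (n + (m + 1))) := by
  have hz := one_sub_zpow_ne_zero hQ (e := n + m + 1) (by lia)
  have h' := (Equiv.addRight (1 : ℤ)).hasSum_iff.mpr (h.mul_left (Q / a * Q ^ m))
  have h2 := (h.add h').mul_left (1 - Q ^ (n + m + 1))⁻¹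
  rw [qPochRecip_eq_add_one hQ (n + m)] at h2
  refine h2.of_eq (fun j => ?_) ?_
  · have e2 : qPochRecip Q (m + j) = (1 - Q ^ (m + 1 + j)) * qPochRecip Q (m + 1 + j) := by
      rw [← qPochRecip_sub_one hQ]; ring_nf
    have e3 : qPochRecip Q (n - (j + 1)) = (1 - Q ^ (n - j)) * qPochRecip Q (n - j) := by
      rw [← qPochRecip_sub_one hQ]; ring_nf
    have e4 : qPochRecip Q (m + (j + 1)) = qPochRecip Q (m + 1 + j) := by ring_nf
    have e5 : Q ^ (m + 1 + j) = Q * Q ^ m * Q ^ j := by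
      rw [zpow_add₀ h0, zpow_add_one₀ h0]; ring
    have e6 : Q ^ (n + m + 1) = Q ^ (n - j) * (Q * Q ^ m * Q ^ j) := by
      rw [← e5, ← zpow_add₀ h0]; ring_nf
    rw [eq_inv_mul_iff_mul_eq₀ hz]
    simp only [Function.comp_apply, Equiv.coe_addRight]
    rw [thetaTerm_add_one ha h0, e2, e3, e4, e5, e6]
    field_simp
    ring
  · rw [eq_inv_mul_iff_mul_eq₀ hz, show n + (m + 1) = n + m + 1 by ring]
    ring

/-- The finite form of the Jacobi triple product identity. -/
theorem hasSum_finite_jacobi {a Q : ℂ} (ha : a ≠ 0) (h0 : Q ≠ 0) (hQ : ‖Q‖ < 1) (n m : ℕ) :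
    HasSum (fun j : ℤ => thetaTerm a Q j * qPochRecip Q (m + j) * qPochRecip Q (n - j))
      (qPoch (-a) Q n * qPoch (-Q / a) Q m * qPochRecip Q (n + m)) := by
  induction n with
  | zero =>
    induction m with
    | zero => simpa [qPoch, qPochRecip_zero] using hasSum_finite_jacobi_zero a Q
    | succ m ih =>
      have h := hasSum_finite_jacobi_right ha h0 hQ (by lia) ih
      refine h.of_eq (fun j => by push_cast; rfl) ?_
      rw [qPoch_succ, zpow_natCast]; push_cast; ring
  | succ n ih =>
    have h := hasSum_finite_jacobi_left ha h0 hQ (by lia) ih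
    refine h.of_eq (fun j => by push_cast; rfl) ?_
    rw [qPoch_succ, zpow_natCast]; push_cast; ring

/-! ### Finite Cauchy identity -/

/-- A finite form of Cauchy's identity, an instance of the `q`-Vandermonde summation. -/
theorem hasSum_finite_cauchy {Q : ℂ} (h0 : Q ≠ 0) (hQ : ‖Q‖ < 1) (N : ℕ) (c : ℤ) :
    HasSum (fun k : ℤ => Q ^ (k * (k + c)) * qPochRecip Q k * qPochRecip Q (N - k) *
      qPochRecip Q (k + c)) (qPochRecip Q N * qPochRecip Q (N + c)) := by
  induction N generalizing c with
  | zero =>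
    have h : HasSum (fun k : ℤ => Q ^ (k * (k + c)) * qPochRecip Q k * qPochRecip Q ((0 : ℕ) - k) *
        qPochRecip Q (k + c)) (Q ^ (0 * (0 + c)) * qPochRecip Q 0 * qPochRecip Q ((0 : ℕ) - 0) *
        qPochRecip Q (0 + c)) := by
      refine hasSum_single 0 fun k hk => ?_
      rcases lt_or_gt_of_ne hk with h | h
      · rw [qPochRecip_of_neg Q h]; simp
      · rw [qPochRecip_of_neg Q (e := (0 : ℕ) - k) (by lia)]; simp
    simpa [qPochRecip_zero] using h
  | succ N ih =>
    have hz := one_sub_zpow_ne_zero hQ (e := (N : ℤ) + 1) (by lia)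
    have hS : Summable fun k : ℤ => Q ^ (k + (c + 1)) * (Q ^ (k * (k + (c + 1))) *
        qPochRecip Q k * qPochRecip Q (N - k) * qPochRecip Q (k + (c + 1))) := by
      refine summable_of_ne_finset_zero (s := Finset.Icc 0 (N : ℤ)) fun k hk => ?_
      rcases lt_or_ge k 0 with h | h
      · rw [qPochRecip_of_neg Q h]; simp
      · have h' : (N : ℤ) - k < 0 := by
          simp only [Finset.mem_Icc, not_and, not_le] at hk
          linarith [hk h]
        rw [qPochRecip_of_neg Q h']; simp
    have h' := (Equiv.subRight (1 : ℤ)).hasSum_iff.mpr hS.hasSum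
    -- If $T(k)$ is the summand for $(N,c+1)$ and $W(k)=Q^{k+c+1}T(k)$, the summand for $(N+1,c)$
    -- times $1-Q^{N+1}$ is $T(k)-W(k)+W(k-1)$; the sums of $W$ cancel.
    have h2 := (((ih (c + 1)).sub hS.hasSum).add h').mul_left (1 - Q ^ ((N : ℤ) + 1))⁻¹
    rw [sub_add_cancel] at h2
    refine h2.of_eq (fun k => ?_) ?_
    · have e1 : qPochRecip Q (k + c) = (1 - Q ^ (k + (c + 1))) * qPochRecip Q (k + (c + 1)) := by
        rw [← qPochRecip_sub_one hQ]; ring_nf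
      have e2 : qPochRecip Q ((N : ℤ) - k) =
          (1 - Q ^ ((N : ℤ) + 1 - k)) * qPochRecip Q ((N : ℤ) + 1 - k) := by
        rw [← qPochRecip_sub_one hQ]; ring_nf
      have e3 : qPochRecip Q ((N : ℤ) - (k - 1)) = qPochRecip Q ((N : ℤ) + 1 - k) := by ring_nf
      have e4 : k - 1 + (c + 1) = k + c := by ring
      have e5 : Q ^ ((k - 1) * (k + c)) * Q ^ (k + c) = Q ^ (k * (k + c)) := by
        rw [← zpow_add₀ h0]; ring_nf
      have e6 : Q ^ (k * (k + (c + 1))) = Q ^ (k * (k + c)) * Q ^ k := by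
        rw [← zpow_add₀ h0]; ring_nf
      have e7 : Q ^ ((N : ℤ) + 1) = Q ^ ((N : ℤ) + 1 - k) * Q ^ k := by
        rw [← zpow_add₀ h0]; ring_nf
      rw [eq_inv_mul_iff_mul_eq₀ hz]
      simp only [Function.comp_apply, Equiv.subRight_apply]
      push_cast
      rw [e4, e3, e2, e6, e7, qPochRecip_sub_one hQ, ← e5]
      linear_combination (-(Q ^ ((k - 1) * (k + c)) * Q ^ (k + c) * Q ^ k * qPochRecip Q k *
        (1 - Q ^ ((N : ℤ) + 1 - k)) * qPochRecip Q ((N : ℤ) + 1 - k))) * (-e1)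
    · have e1 := qPochRecip_eq_add_one hQ (N : ℤ)
      rw [eq_inv_mul_iff_mul_eq₀ hz, e1]
      push_cast
      rw [show (N : ℤ) + 1 + c = N + (c + 1) by ring]
      ring

/-! ### Passage to the limit: Jacobi and Cauchy -/

theorem qPochInf_self_ne_zero {Q : ℂ} (hQ : ‖Q‖ < 1) : qPochInf Q Q ≠ 0 := by
  have h := tprod_one_add_ne_zero_of_summable (f := fun k : ℕ => -(Q * Q ^ k))
    (fun k => by simpa [← sub_eq_add_neg] using one_sub_pow_ne_zero hQ k)
    (by simpa using (summable_geometric_of_lt_one (norm_nonneg Q) hQ).mul_left ‖Q‖)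
  simpa [qPochInf, sub_eq_add_neg] using h

theorem tendsto_qPochRecip {Q : ℂ} (hQ : ‖Q‖ < 1) :
    Tendsto (fun n : ℕ => qPochRecip Q n) atTop (𝓝 (qPochInf Q Q)⁻¹) := by
  simp only [qPochRecip_natCast]
  exact (qPoch_tendsto Q Q hQ).inv₀ (qPochInf_self_ne_zero hQ)

theorem tendsto_qPochRecip_comp {Q : ℂ} (hQ : ‖Q‖ < 1) {u : ℕ → ℤ} (hu : Tendsto u atTop atTop) :
    Tendsto (fun n => qPochRecip Q (u n)) atTop (𝓝 (qPochInf Q Q)⁻¹) := by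
  have h1 : Tendsto (fun n => (u n).toNat) atTop atTop :=
    tendsto_atTop.mpr fun b => by
      filter_upwards [hu.eventually_ge_atTop (b : ℤ)] with n hn
      lia
  refine ((tendsto_qPochRecip hQ).comp h1).congr' ?_
  filter_upwards [hu.eventually_ge_atTop 0] with n hn
  simp [Int.toNat_of_nonneg hn]

/-- A convergent sequence is bounded; this constant supplies every dominating bound below. -/
theorem exists_norm_qPochRecip_le {Q : ℂ} (hQ : ‖Q‖ < 1) :
    ∃ C : ℝ, 0 < C ∧ ∀ e : ℤ, ‖qPochRecip Q e‖ ≤ C := by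
  obtain ⟨C, hC⟩ := (tendsto_qPochRecip hQ).norm.bddAbove_range
  have hC' : ∀ n : ℕ, ‖qPochRecip Q n‖ ≤ C := fun n => hC ⟨n, rfl⟩
  have h1 : (1 : ℝ) ≤ C := by simpa [qPochRecip_zero] using hC' 0
  refine ⟨C, by linarith, fun e => ?_⟩
  rcases lt_or_ge e 0 with he | he
  · rw [qPochRecip_of_neg Q he, norm_zero]; linarith
  · lift e to ℕ using he
    exact hC' e

theorem tendsto_natCast_add_int (j : ℤ) : Tendsto (fun n : ℕ => (n : ℤ) + j) atTop atTop :=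
  tendsto_atTop_add_const_right _ _ tendsto_natCast_atTop_atTop

theorem summable_nat_thetaTerm {a Q : ℂ} (ha : a ≠ 0) (h0 : Q ≠ 0) (hQ : ‖Q‖ < 1) :
    Summable fun n : ℕ => thetaTerm a Q n := by
  have hne : ∀ j : ℤ, thetaTerm a Q j ≠ 0 := fun j =>
    mul_ne_zero (zpow_ne_zero _ ha) (zpow_ne_zero _ h0)
  refine summable_of_ratio_test_tendsto_lt_one (l := 0) one_pos (.of_forall fun n => hne n) ?_
  have h : Tendsto (fun n : ℕ => ‖a‖ * ‖Q‖ ^ n) atTop (𝓝 (‖a‖ * 0)) :=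
    (tendsto_pow_atTop_nhds_zero_of_lt_one (norm_nonneg Q) hQ).const_mul _
  rw [mul_zero] at h
  refine h.congr fun n => ?_
  rw [Nat.cast_add_one, thetaTerm_add_one ha h0, norm_mul,
    mul_div_cancel_right₀ _ (norm_ne_zero_iff.mpr (hne n)), norm_mul, zpow_natCast, norm_pow]

theorem triExp_neg (j : ℤ) : triExp (-j) = triExp j + j := by
  have h1 := two_mul_triExp j
  have h2 := two_mul_triExp (-j)
  linarith

theorem thetaTerm_neg {a Q : ℂ} (h0 : Q ≠ 0) (j : ℤ) :
    thetaTerm a Q (-j) = thetaTerm (Q / a) Q j := by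
  simp only [thetaTerm, triExp_neg, zpow_add₀ h0, div_zpow, zpow_neg]
  ring

theorem summable_thetaTerm {a Q : ℂ} (ha : a ≠ 0) (h0 : Q ≠ 0) (hQ : ‖Q‖ < 1) :
    Summable (thetaTerm a Q) := by
  refine Summable.of_nat_of_neg (summable_nat_thetaTerm ha h0 hQ) ?_
  simp only [thetaTerm_neg h0]
  exact summable_nat_thetaTerm (div_ne_zero h0 ha) h0 hQ

/-- The Jacobi triple product identity. -/
theorem hasSum_jacobi {a Q : ℂ} (ha : a ≠ 0) (h0 : Q ≠ 0) (hQ : ‖Q‖ < 1) :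
    HasSum (thetaTerm a Q) (qPochInf (-a) Q * qPochInf (-Q / a) Q * qPochInf Q Q) := by
  obtain ⟨C, hC0, hC⟩ := exists_norm_qPochRecip_le hQ
  have hs := summable_thetaTerm ha h0 hQ
  have hne := qPochInf_self_ne_zero hQ
  -- Take both finite lengths equal to $n\to\infty$; a common factor $1/(Q;Q)_\infty$ then cancels
  -- from the two limits.
  have hlim := tendsto_tsum_of_dominated_convergence (𝓕 := atTop)
    (f := fun (n : ℕ) (j : ℤ) =>
      thetaTerm a Q j * qPochRecip Q (n + j) * qPochRecip Q (n - j))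
    (g := fun j => thetaTerm a Q j * (qPochInf Q Q)⁻¹ * (qPochInf Q Q)⁻¹)
    (bound := fun j => ‖thetaTerm a Q j‖ * C * C) ((hs.norm.mul_right C).mul_right C)
    (fun j => (tendsto_const_nhds.mul
      (tendsto_qPochRecip_comp hQ (tendsto_natCast_add_int j))).mul
      (tendsto_qPochRecip_comp hQ (tendsto_natCast_add_int (-j))))
    (.of_forall fun n j => by
      rw [norm_mul, norm_mul]
      gcongr
      · exact hC _
      · exact hC _)
  simp only [(hasSum_finite_jacobi ha h0 hQ _ _).tsum_eq, tsum_mul_right] at hlim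
  have hlim' := ((qPoch_tendsto (-a) Q hQ).mul (qPoch_tendsto (-Q / a) Q hQ)).mul
    (tendsto_qPochRecip_comp hQ (u := fun n : ℕ => (n : ℤ) + n)
      (tendsto_natCast_atTop_atTop.atTop_add_atTop tendsto_natCast_atTop_atTop))
  have h := tendsto_nhds_unique hlim hlim'
  refine hs.hasSum.of_eq (fun _ => rfl) ?_
  have h' := mul_right_cancel₀ (inv_ne_zero hne) h
  rw [← h', inv_mul_cancel_right₀ hne]

theorem summable_zpow_quadratic {Q : ℂ} (h0 : Q ≠ 0) (hQ : ‖Q‖ < 1) (c : ℤ) :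
    Summable fun k : ℤ => Q ^ (k * (k + c)) := by
  have hQ2 : ‖Q ^ 2‖ < 1 := by
    rw [norm_pow]; exact pow_lt_one₀ (norm_nonneg _) hQ two_ne_zero
  refine (summable_thetaTerm (a := Q ^ (c + 1)) (zpow_ne_zero _ h0) (pow_ne_zero 2 h0) hQ2).congr
    fun k => ?_
  rw [thetaTerm, ← zpow_natCast, ← zpow_mul, ← zpow_mul, ← zpow_add₀ h0]
  congr 1
  have h := two_mul_triExp k
  push_cast
  linear_combination h

/-- Cauchy's identity. -/
theorem hasSum_cauchy {Q : ℂ} (h0 : Q ≠ 0) (hQ : ‖Q‖ < 1) (c : ℤ) :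
    HasSum (fun k : ℤ => Q ^ (k * (k + c)) * qPochRecip Q k * qPochRecip Q (k + c))
      (qPochInf Q Q)⁻¹ := by
  obtain ⟨C, hC0, hC⟩ := exists_norm_qPochRecip_le hQ
  have hs := summable_zpow_quadratic h0 hQ c
  have hne := qPochInf_self_ne_zero hQ
  have hlim := tendsto_tsum_of_dominated_convergence (𝓕 := atTop)
    (f := fun (N : ℕ) (k : ℤ) => Q ^ (k * (k + c)) * qPochRecip Q k * qPochRecip Q (N - k) *
      qPochRecip Q (k + c))
    (g := fun k => Q ^ (k * (k + c)) * qPochRecip Q k * (qPochInf Q Q)⁻¹ * qPochRecip Q (k + c))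
    (bound := fun k => ‖Q ^ (k * (k + c))‖ * C * C * C)
    (((hs.norm.mul_right C).mul_right C).mul_right C)
    (fun k => (tendsto_const_nhds.mul
      (tendsto_qPochRecip_comp hQ (tendsto_natCast_add_int (-k)))).mul tendsto_const_nhds)
    (.of_forall fun N k => by
      rw [norm_mul, norm_mul, norm_mul]
      gcongr
      · exact hC _
      · exact hC _
      · exact hC _)
  simp only [(hasSum_finite_cauchy h0 hQ _ _).tsum_eq] at hlim
  have hlim' := (tendsto_qPochRecip hQ).mul
    (tendsto_qPochRecip_comp hQ (tendsto_natCast_add_int c))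
  have h := tendsto_nhds_unique hlim hlim'
  have hS : Summable fun k : ℤ => Q ^ (k * (k + c)) * qPochRecip Q k * qPochRecip Q (k + c) := by
    refine .of_norm_bounded ((hs.norm.mul_right C).mul_right C) fun k => ?_
    rw [norm_mul, norm_mul]
    gcongr
    · exact hC _
    · exact hC _
  refine hS.hasSum.of_eq (fun _ => rfl) ?_
  simp only [mul_right_comm _ (qPochInf Q Q)⁻¹ _, tsum_mul_right] at h
  exact (mul_right_cancel₀ (inv_ne_zero hne) h).symm

/-- Cauchy's identity, summed along a diagonal. -/
theorem hasSum_cauchy_diagonal {Q : ℂ} (h0 : Q ≠ 0) (hQ : ‖Q‖ < 1) (j : ℤ) :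
    HasSum (fun n : ℕ => Q ^ (n ^ 2 + n) * (qPochRecip Q (n + j) * qPochRecip Q (n + 1 - j)))
      (Q ^ (j * (j - 1)) * (qPochInf Q Q)⁻¹) := by
  -- Put $k=n+j$, $c=1-2j$: then $k(k+c)=n^2+n-j(j-1)$.
  have h := (Equiv.addRight j).hasSum_iff.mpr
    ((hasSum_cauchy h0 hQ (1 - 2 * j)).mul_left (Q ^ (j * (j - 1))))
  have hinj : Function.Injective ((↑) : ℕ → ℤ) := Nat.cast_injective
  refine (hinj.hasSum_iff (fun k hk => ?_)).mpr h |>.of_eq (fun n => ?_) rfl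
  -- The indices $k+j$ and $k+1-j$ add up to $2k+1<0$, so one of them is negative and its reciprocal
  -- is zero.
  · have hk' : k < 0 := by
      by_contra hc
      exact hk ⟨k.toNat, by lia⟩
    simp only [Function.comp_apply, Equiv.coe_addRight]
    rcases lt_or_ge (k + j) 0 with h1 | h1
    · rw [qPochRecip_of_neg Q h1]; simp
    · rw [qPochRecip_of_neg Q (e := k + j + (1 - 2 * j)) (by lia)]; simp
  · simp only [Function.comp_apply, Equiv.coe_addRight]
    rw [← mul_assoc, ← mul_assoc, ← mul_assoc, ← zpow_add₀ h0, ← zpow_natCast]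
    congr 3
    · push_cast; ring
    · ring

/-! ### The double series -/

/-- The general term of the series `∑ Q^(n²+n) (-a; Q)_{n+1} (-Q/a; Q)_n / (Q; Q)_{2n+1}`. -/
noncomputable def oddTerm (a Q : ℂ) (n : ℕ) : ℂ :=
  Q ^ (n ^ 2 + n) * qPoch (-a) Q (n + 1) * qPoch (-Q / a) Q n / qPoch Q Q (2 * n + 1)

theorem hasSum_oddTerm {a Q : ℂ} (ha : a ≠ 0) (h0 : Q ≠ 0) (hQ : ‖Q‖ < 1) :
    HasSum (oddTerm a Q) (∑' j : ℤ, thetaTerm a (Q ^ 3) j / qPochInf Q Q) := by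
  obtain ⟨C, hC0, hC⟩ := exists_norm_qPochRecip_le hQ
  -- Absolutely summable, so it may be summed by rows (finite Jacobi) or by columns (Cauchy).
  let F : ℕ × ℤ → ℂ := fun p => Q ^ (p.1 ^ 2 + p.1) *
    (thetaTerm a Q p.2 * qPochRecip Q (p.1 + p.2) * qPochRecip Q (p.1 + 1 - p.2))
  have hq : Summable fun n : ℕ => Q ^ (n ^ 2 + n) := by
    refine ((summable_zpow_quadratic h0 hQ 1).comp_injective
      (i := ((↑) : ℕ → ℤ)) Nat.cast_injective).congr fun n => ?_
    rw [Function.comp_apply, ← zpow_natCast]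
    congr 1
    push_cast
    ring
  have hF : Summable F := by
    refine .of_norm_bounded ((hq.norm.mul_of_nonneg (summable_thetaTerm ha h0 hQ).norm
      (fun _ => norm_nonneg _) (fun _ => norm_nonneg _)).mul_right (C * C)) fun p => ?_
    simp only [F, norm_mul]
    rw [← mul_assoc, ← mul_assoc, mul_assoc _ _ ‖qPochRecip Q (p.1 + 1 - p.2)‖]
    gcongr
    · exact hC _
    · exact hC _
  have hrow : ∀ n : ℕ, HasSum (fun j => F (n, j)) (oddTerm a Q n) := fun n => by
    refine ((hasSum_finite_jacobi ha h0 hQ (n + 1) n).mul_left (Q ^ (n ^ 2 + n))).of_eq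
      (fun j => by simp [F]) ?_
    rw [← Nat.cast_add, qPochRecip_natCast, oddTerm, show n + 1 + n = 2 * n + 1 by ring]
    ring
  have hcol : ∀ j : ℤ, HasSum (fun n => F (n, j)) (thetaTerm a (Q ^ 3) j / qPochInf Q Q) :=
    fun j => by
      refine ((hasSum_cauchy_diagonal h0 hQ j).mul_left (thetaTerm a Q j)).of_eq
        (fun n => by simp only [F]; ring) ?_
      have h3 : (Q ^ 3) ^ triExp j = Q ^ triExp j * Q ^ (j * (j - 1)) := by
        rw [← two_mul_triExp, ← zpow_add₀ h0, ← zpow_natCast, ← zpow_mul]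
        congr 1
        push_cast
        ring
      rw [thetaTerm, thetaTerm, h3]
      ring
  have h1 := hF.hasSum.prod_fiberwise hrow
  have h2 := ((Equiv.prodComm ℤ ℕ).hasSum_iff.mpr hF.hasSum).prod_fiberwise hcol
  rwa [h2.tsum_eq]

/-! ### Products and Ramanujan's theta function -/

theorem norm_pow_three_lt_one {Q : ℂ} (hQ : ‖Q‖ < 1) : ‖Q ^ 3‖ < 1 := by
  rw [norm_pow]; exact pow_lt_one₀ (norm_nonneg _) hQ three_ne_zero

/-- Splitting `(Q; Q)_∞` according to residues modulo three. -/
theorem qPochInf_trisection {Q : ℂ} (hQ : ‖Q‖ < 1) :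
    qPochInf Q (Q ^ 3) * qPochInf (Q ^ 2) (Q ^ 3) * qPochInf (Q ^ 3) (Q ^ 3) = qPochInf Q Q := by
  have h3 := norm_pow_three_lt_one hQ
  have h : ∀ n, qPoch Q (Q ^ 3) n * qPoch (Q ^ 2) (Q ^ 3) n * qPoch (Q ^ 3) (Q ^ 3) n =
      qPoch Q Q (3 * n) := fun n => by
    induction n with
    | zero => simp [qPoch]
    | succ n ih =>
      rw [show 3 * (n + 1) = 3 * n + 1 + 1 + 1 by ring]
      simp only [qPoch_succ, ← ih]
      ring
  have hl := ((qPoch_tendsto Q _ h3).mul (qPoch_tendsto (Q ^ 2) _ h3)).mul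
    (qPoch_tendsto (Q ^ 3) _ h3)
  simp only [h] at hl
  exact tendsto_nhds_unique hl ((qPoch_tendsto Q Q hQ).comp
    (tendsto_id.const_mul_atTop' (by norm_num : 0 < 3)))

theorem ramanujanTheta_eq_tsum {a b : ℂ} (ha : a ≠ 0) :
    ramanujanTheta a b = ∑' j : ℤ, thetaTerm a (a * b) j := by
  refine tsum_congr fun j => ?_
  have h : j * (j + 1) / 2 = j + triExp j := by
    have h1 := two_mul_triExp j
    rw [show j * (j + 1) = 2 * (j + triExp j) by linear_combination -h1]
    simp
  rw [thetaTerm, h, mul_zpow, zpow_add₀ ha, mul_assoc]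
  rfl

theorem ramanujanTheta_euler {Q : ℂ} (h0 : Q ≠ 0) (hQ : ‖Q‖ < 1) :
    ramanujanTheta (-Q) (-Q ^ 2) = qPochInf Q Q := by
  rw [ramanujanTheta_eq_tsum (neg_ne_zero.mpr h0), show -Q * -Q ^ 2 = Q ^ 3 by ring,
    (hasSum_jacobi (neg_ne_zero.mpr h0) (pow_ne_zero 3 h0) (norm_pow_three_lt_one hQ)).tsum_eq,
    ← qPochInf_trisection hQ, neg_neg, neg_div_neg_eq, show Q ^ 3 / Q = Q ^ 2 by field_simp]

/-! ### Dissection modulo m -/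

theorem dissectionTerm_eq_oddTerm {m : ℕ} {z q s : ℂ} (hs0 : s ≠ 0) (hs : s ^ 2 = q) (r n : ℕ) :
    dissectionTerm m z q s r n =
      oddTerm (s ^ (3 * m ^ 2) * z ^ m * s ^ (3 * (m : ℤ) * (2 * (r : ℤ) - 1))) (q ^ m ^ 2) n := by
  have h : -1 / (s ^ m ^ 2 * z ^ m * s ^ (3 * (m : ℤ) * (2 * (r : ℤ) - 1))) =
      -q ^ m ^ 2 / (s ^ (3 * m ^ 2) * z ^ m * s ^ (3 * (m : ℤ) * (2 * (r : ℤ) - 1))) := by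
    have h3 : s ^ (3 * m ^ 2) = q ^ m ^ 2 * s ^ m ^ 2 := by
      rw [← hs, ← pow_mul, ← pow_add]; ring_nf
    have hq : q ^ m ^ 2 ≠ 0 := by rw [← hs]; positivity
    rw [h3, mul_assoc (q ^ m ^ 2), mul_assoc (q ^ m ^ 2), neg_div, neg_div,
      ← div_div (q ^ m ^ 2), div_self hq]
  rw [dissectionTerm, oddTerm, h, ← pow_mul]

/-- For $k=jm+r$, $k(k-1)=r(r-1)+jm(m+2r-1)+m^2j(j-1)$. Powers of $s$ keep the half-integral
exponents of $q$ integral. -/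
theorem thetaTerm_dissection {m : ℕ} {z q s : ℂ} (hz : z ≠ 0) (hs0 : s ≠ 0) (hs : s ^ 2 = q)
    (r : ℕ) (j : ℤ) :
    q ^ (3 * r * (r - 1) / 2) * z ^ r *
      thetaTerm (s ^ (3 * m ^ 2) * z ^ m * s ^ (3 * (m : ℤ) * (2 * (r : ℤ) - 1)))
        ((q ^ m ^ 2) ^ 3) j = thetaTerm z (q ^ 3) (j * m + r) := by
  have hr : ((2 * (3 * r * (r - 1) / 2) : ℕ) : ℤ) = 3 * r * ((r : ℤ) - 1) := by
    have hd : 2 ∣ 3 * r * (r - 1) := by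
      rw [mul_assoc]
      exact (Nat.even_mul_pred_self r).two_dvd.mul_left 3
    rw [Nat.mul_div_cancel' hd]
    rcases r with _ | r
    · simp
    · push_cast [Nat.add_sub_cancel]; ring
  have hj := two_mul_triExp j
  have hk := two_mul_triExp (j * m + r)
  subst hs
  simp only [thetaTerm, mul_zpow, ← zpow_natCast, ← zpow_mul]
  have hzz : z ^ (j * m + r) = z ^ (r : ℤ) * z ^ ((m : ℤ) * j) := by
    rw [← zpow_add₀ hz]; ring_nf
  have e : s ^ (((2 : ℕ) : ℤ) * ((3 : ℕ) : ℤ) * triExp (j * m + r)) =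
      s ^ (((2 : ℕ) : ℤ) * ((3 * r * (r - 1) / 2 : ℕ) : ℤ)) * s ^ (((3 * m ^ 2 : ℕ) : ℤ) * j) *
      s ^ (3 * (m : ℤ) * (2 * (r : ℤ) - 1) * j) *
      s ^ (((2 : ℕ) : ℤ) * ((m ^ 2 : ℕ) : ℤ) * ((3 : ℕ) : ℤ) * triExp j) := by
    rw [← zpow_add₀ hs0, ← zpow_add₀ hs0, ← zpow_add₀ hs0, ← Nat.cast_mul 2 (3 * r * (r - 1) / 2), hr]
    congr 1
    push_cast
    linear_combination 3 * hk - 3 * (m : ℤ) ^ 2 * hj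
  rw [hzz, e]
  ring

theorem norm_pow_sq_lt_one {m : ℕ} (hm : 0 < m) {q : ℂ} (hq : ‖q‖ < 1) : ‖q ^ m ^ 2‖ < 1 := by
  rw [norm_pow]; exact pow_lt_one₀ (norm_nonneg _) hq (by positivity)

theorem dissection_identity {m : ℕ} (hm : 0 < m) {z q s : ℂ} (hz : z ≠ 0) (hq0 : q ≠ 0)
    (hq : ‖q‖ < 1) (hs : s ^ 2 = q) :
    (∀ r : ℕ, Summable fun n : ℕ => dissectionTerm m z q s r n) ∧
      ∑ r ∈ Finset.range m, q ^ (3 * r * (r - 1) / 2) * z ^ r *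
          ∑' n : ℕ, dissectionTerm m z q s r n
        = qPochInf (-z) (q ^ 3) * qPochInf (-q ^ 3 / z) (q ^ 3) * qPochInf (q ^ 3) (q ^ 3)
          / qPochInf (q ^ m ^ 2) (q ^ m ^ 2) := by
  have hs0 : s ≠ 0 := by rintro rfl; exact hq0 (by simp [← hs])
  have hQ := norm_pow_sq_lt_one hm hq
  have hQ0 : q ^ m ^ 2 ≠ 0 := pow_ne_zero _ hq0
  have hA : ∀ r : ℕ, s ^ (3 * m ^ 2) * z ^ m * s ^ (3 * (m : ℤ) * (2 * (r : ℤ) - 1)) ≠ 0 :=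
    fun r => mul_ne_zero (mul_ne_zero (pow_ne_zero _ hs0) (pow_ne_zero _ hz)) (zpow_ne_zero _ hs0)
  have hsum := fun r : ℕ => hasSum_oddTerm (hA r) hQ0 hQ
  simp only [dissectionTerm_eq_oddTerm hs0 hs]
  refine ⟨fun r => (hsum r).summable, ?_⟩
  have : NeZero m := ⟨hm.ne'⟩
  have hJ := (hasSum_jacobi hz (pow_ne_zero 3 hq0) (norm_pow_three_lt_one hq)).div_const
    (qPochInf (q ^ m ^ 2) (q ^ m ^ 2))
  -- Reindex $\mathbb Z$ by $(r,j)\mapsto jm+r$.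
  have hJ' := ((Equiv.prodComm (Fin m) ℤ).trans (Int.divModEquiv m).symm).hasSum_iff.mpr hJ
  have hrow := hJ'.prod_fiberwise fun r => (hJ'.summable.prod_factor r).hasSum
  rw [← hrow.unique (hasSum_fintype _) |>.symm, Finset.sum_range]
  refine Finset.sum_congr rfl fun r _ => ?_
  rw [(hsum r).tsum_eq, ← tsum_mul_left]
  refine tsum_congr fun j => ?_
  rw [← mul_div_assoc, thetaTerm_dissection hz hs0 hs]
  simp

/-! ### The partner identity -/

theorem partnerTerm_eq_oddTerm (a x : ℂ) (n : ℕ) : partnerTerm a x n = oddTerm a (x ^ 2) n := by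
  rw [partnerTerm, oddTerm, ← pow_mul]
  ring_nf

theorem hasSum_partnerTerm_zero (a : ℂ) : HasSum (partnerTerm a 0) (1 + a) := by
  have h : HasSum (partnerTerm a 0) (partnerTerm a 0 0) :=
    hasSum_single 0 fun n hn => by simp [partnerTerm, hn]
  simpa [partnerTerm, qPoch] using h

/-- Only $j=0,1$ give $0^0=1$. This settles $x=0$, which `hasSum_oddTerm` excludes. -/
theorem ramanujanTheta_zero_right (a : ℂ) : ramanujanTheta a 0 = 1 + a := by
  have h : ∀ j ∉ ({0, 1} : Finset ℤ), a ^ (j * (j + 1) / 2) * (0 : ℂ) ^ (j * (j - 1) / 2) = 0 := by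
    intro j hj
    have h1 : j * (j - 1) / 2 ≠ 0 := fun h => by
      have h2 := two_mul_triExp j
      rw [triExp, h, mul_zero, eq_comm, mul_eq_zero] at h2
      simp only [Finset.mem_insert, Finset.mem_singleton] at hj
      lia
    rw [zero_zpow _ h1, mul_zero]
  rw [ramanujanTheta, tsum_eq_sum h]
  simp

theorem partner_identity {a x : ℂ} (ha : a ≠ 0) (hx : ‖x‖ < 1) :
    HasSum (partnerTerm a x)
      (ramanujanTheta a (x ^ 6 / a) / ramanujanTheta (-x ^ 2) (-x ^ 4)) := by
  rcases eq_or_ne x 0 with rfl | h0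
  · simpa [ramanujanTheta_zero_right] using hasSum_partnerTerm_zero a
  · have hQ : ‖x ^ 2‖ < 1 := by
      rw [norm_pow]; exact pow_lt_one₀ (norm_nonneg _) hx two_ne_zero
    have h2 : x ^ 2 ≠ 0 := pow_ne_zero 2 h0
    refine (hasSum_oddTerm ha h2 hQ).of_eq (partnerTerm_eq_oddTerm a x) ?_
    rw [tsum_div_const, ramanujanTheta_eq_tsum ha, mul_div_cancel₀ _ ha,
      show -x ^ 4 = -(x ^ 2) ^ 2 by ring, ramanujanTheta_euler h2 hQ, ← pow_mul]

theorem dissectionTerm_one {a x : ℂ} (hx : x ≠ 0) (n : ℕ) :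
    dissectionTerm 1 a (x ^ 2) x 0 n = partnerTerm a x n := by
  rw [dissectionTerm_eq_oddTerm hx rfl, partnerTerm_eq_oddTerm]
  congr 1
  · simp [zpow_neg]
    field_simp
  · simp

/-- First part: the `m`-dissection identity, for every positive integer `m` and either choice `s`
of the square root of `q`. Second part: the partner identity, and the fact that its series is
term by term the one of the case `m = 1`. All series converge (absolutely). -/
theorem mainTheorem8 :
    (∀ (m : ℕ) (_ : 0 < m) (z q s : ℂ) (_ : z ≠ 0) (_ : q ≠ 0) (_ : ‖q‖ < 1) (_ : s ^ 2 = q),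
      (∀ r ∈ Finset.range m, Summable fun n : ℕ => dissectionTerm m z q s r n) ∧
      ∑ r ∈ Finset.range m, q ^ (3 * r * (r - 1) / 2) * z ^ r *
          ∑' n : ℕ, dissectionTerm m z q s r n
        = qPochInf (-z) (q ^ 3) * qPochInf (-q ^ 3 / z) (q ^ 3) * qPochInf (q ^ 3) (q ^ 3)
          / qPochInf (q ^ m ^ 2) (q ^ m ^ 2)) ∧
    (∀ (a x : ℂ) (_ : a ≠ 0) (_ : ‖x‖ < 1),
      (Summable fun n : ℕ => partnerTerm a x n) ∧
      ∑' n : ℕ, partnerTerm a x n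
        = ramanujanTheta a (x ^ 6 / a) / ramanujanTheta (-x ^ 2) (-x ^ 4)) ∧
    (∀ (a x : ℂ) (_ : a ≠ 0) (_ : x ≠ 0) (n : ℕ),
      dissectionTerm 1 a (x ^ 2) x 0 n = partnerTerm a x n) := by
  refine ⟨fun m hm z q s hz hq0 hq hs => ?_, fun a x ha hx => ?_, fun a x _ hx n => ?_⟩
  · obtain ⟨h1, h2⟩ := dissection_identity hm hz hq0 hq hs
    exact ⟨fun r _ => h1 r, h2⟩
  · have h := partner_identity ha hx
    exact ⟨h.summable, h.tsum_eq⟩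
  · exact dissectionTerm_one hx n
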